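/- Let $n\ge 0$, and let $\mathcal M$ be the field of meromorphic functions on $\mathbb C^n$, with coordinate functions $x_1,\dots,x_n$. Let $\tilde{\mathcal E}_n(\psi_{ij}=0)$ be the associative unital $\mathbb C$-algebra generated by the $\mathbb C$-algebra $\mathcal M$ and symbols $[ij]$ ($1\le i\ne j\le n$), subject to the relations - $[ji]=-[ij]$ and $[ij]^2=0$; - $[ij][kl]=[kl][ij]$ if $\{i,j\}\cap\{k,l\}=\emptyset$; - $[ij][jk]+[jk][ki]+[ki][ij]=0$ for distinct $i,j,k$; - $[ij]f(\xi)=f(s_{ij}\xi)[ij]$ for $f\in\mathcal M$, where $s_{ij}$ exchanges the $i$-th and $j$-th coordinates (in particular $[ij]x_i=x_j[ij]$). Put $\theta'_i=x_i+\sum_{j\ne i}[ij]$ for $1\le i\le n$; these elements commute pairwise. Let $I\subset\{1,\dots,n\}$ and let $k\ge 0$ be an integer. Then in $\tilde{\mathcal E}_n(\psi_{ij}=0)$ $$e_k(\theta'_i\mid i\in I)=\sum_{m=0}^{k}\ \sum_{I_0\subset I,\ \#I_0=m}\Big(\prod_{i\in I_0}x_i\Big)\sum_{(*)}[a_1b_1]\cdots[a_{k-m}b_{k-m}],$$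 where $e_k$ is the $k$-th elementary symmetric polynomial and $(*)$ means that the sum runs over all pairs of sequences $(a_1,\dots,a_{k-m})$, $(b_1,\dots,b_{k-m})$ in $\{1,\dots,n\}$ such that $a_i\in I\setminus I_0$ and $b_i\notin I$ for all $i$, the $a_1,\dots,a_{k-m}$ are distinct, and $b_1\le\cdots\le b_{k-m}$. In particular, $$e_k(\theta'_1,\dots,\theta'_n)=e_k(x_1,\dots,x_n)\qquad\text{for all }k\ge 0.$$ -/

import Mathlib

open Finset

noncomputable section

namespace FKDegenerate

/-! ### Meromorphic functions on `ℂⁿ` -/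

/-- The `ℂ`-algebra of entire functions on `ℂⁿ`. -/
def Entire (n : ℕ) : Subalgebra ℂ ((Fin n → ℂ) → ℂ) where
  carrier := {f | AnalyticOnNhd ℂ f Set.univ}
  mul_mem' hf hg := AnalyticOnNhd.mul hf hg
  add_mem' hf hg := AnalyticOnNhd.add hf hg
  algebraMap_mem' _ := analyticOnNhd_const

instance (n : ℕ) : IsDomain (Entire n) := by
  have : NoZeroDivisors (Entire n) := by
    refine ⟨fun {f g} h => ?_⟩
    by_contra! hc
    obtain ⟨hf, hg⟩ := hc
    apply hg
    obtain ⟨a, ha⟩ : ∃ a, f.1 a ≠ 0 := by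
      by_contra! hz
      exact hf (Subtype.ext (funext hz))
    have h0 : g.1 =ᶠ[nhds a] 0 := by
      filter_upwards [(f.2 a trivial).continuousAt.eventually_ne ha] with z hz
      have := congrFun (congrArg Subtype.val h) z
      exact (mul_eq_zero.mp this).resolve_left hz
    apply Subtype.ext
    exact AnalyticOnNhd.eq_of_eventuallyEq g.2 (fun _ _ => analyticAt_const) h0
  exact NoZeroDivisors.to_isDomain _

/-- The field of meromorphic functions on `ℂⁿ`. Every meromorphic function on `ℂⁿ` is globally a
quotient of two entire functions, so this is the fraction field of the ring of entire functions. -/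
abbrev Mero (n : ℕ) : Type := FractionRing (Entire n)

/-- The automorphism `f(ξ) ↦ f(s_{ij} ξ)` of the entire functions, where `s_{ij}` exchanges the
`i`-th and the `j`-th coordinate of `ξ`. -/
def Entire.swap {n : ℕ} (i j : Fin n) : Entire n ≃+* Entire n where
  toFun f := ⟨fun ξ => f.1 (fun k => ξ (Equiv.swap i j k)), fun ξ _ =>
    (f.2 _ trivial).comp (g := f.1) (f := fun ξ : Fin n → ℂ => fun k => ξ (Equiv.swap i j k))
      ((ContinuousLinearMap.pi fun k => ContinuousLinearMap.proj (R := ℂ)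
        (φ := fun _ : Fin n => ℂ) (Equiv.swap i j k)).analyticAt ξ)⟩
  invFun f := ⟨fun ξ => f.1 (fun k => ξ (Equiv.swap i j k)), fun ξ _ =>
    (f.2 _ trivial).comp (g := f.1) (f := fun ξ : Fin n → ℂ => fun k => ξ (Equiv.swap i j k))
      ((ContinuousLinearMap.pi fun k => ContinuousLinearMap.proj (R := ℂ)
        (φ := fun _ : Fin n => ℂ) (Equiv.swap i j k)).analyticAt ξ)⟩
  left_inv f := by ext ξ; simp
  right_inv f := by ext ξ; simp
  map_mul' _ _ := rfl
  map_add' _ _ := rfl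

/-- The induced automorphism `f(ξ) ↦ f(s_{ij} ξ)` of the meromorphic functions. -/
def Mero.swap {n : ℕ} (i j : Fin n) : Mero n ≃+* Mero n :=
  IsFractionRing.ringEquivOfRingEquiv (Entire.swap i j)

/-- The `i`-th coordinate function `ξ ↦ ξ i`, as an entire function. -/
def Entire.coord {n : ℕ} (i : Fin n) : Entire n :=
  ⟨fun ξ => ξ i, fun ξ _ =>
    (ContinuousLinearMap.proj (R := ℂ) (φ := fun _ : Fin n => ℂ) i).analyticAt ξ⟩

/-- The `i`-th coordinate function, as a meromorphic function. -/
def Mero.coord {n : ℕ} (i : Fin n) : Mero n := algebraMap (Entire n) (Mero n) (Entire.coord i)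

theorem Entire.swap_coord {n : ℕ} (i j k : Fin n) :
    Entire.swap i j (Entire.coord k) = Entire.coord (Equiv.swap i j k) := rfl

theorem Mero.swap_coord {n : ℕ} (i j k : Fin n) :
    Mero.swap i j (Mero.coord k) = Mero.coord (Equiv.swap i j k) := by
  rw [Mero.swap, Mero.coord, IsFractionRing.ringEquivOfRingEquiv_algebraMap, Entire.swap_coord]
  rfl

/-! ### The degenerate algebra -/

/-- Generators: the brackets `[ij]` and the meromorphic functions on `ℂⁿ`. -/
inductive Gen (n : ℕ) : Type
  | br (i j : Fin n) : Gen n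
  | fn (f : Mero n) : Gen n

/-- The bracket `[ij]` in the free algebra on the generators. -/
def Gen.B {n : ℕ} (i j : Fin n) : FreeAlgebra ℂ (Gen n) := FreeAlgebra.ι ℂ (Gen.br i j)

/-- The function `f` in the free algebra on the generators. -/
def Gen.F {n : ℕ} (f : Mero n) : FreeAlgebra ℂ (Gen n) := FreeAlgebra.ι ℂ (Gen.fn f)

open Gen in
/-- The defining relations. The first three say that the functions form a homomorphic image of the
`ℂ`-algebra of meromorphic functions. The bracket `[ij]` is meant for `i ≠ j` only; the superfluous
symbols `[ii]` are set to zero. -/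
inductive Rel (n : ℕ) : FreeAlgebra ℂ (Gen n) → FreeAlgebra ℂ (Gen n) → Prop
  | add (f g : Mero n) : Rel n (F (f + g)) (F f + F g)
  | mul (f g : Mero n) : Rel n (F (f * g)) (F f * F g)
  | scalar (c : ℂ) : Rel n (F (algebraMap ℂ (Mero n) c)) (algebraMap ℂ _ c)
  | diag (i : Fin n) : Rel n (B i i) 0
  | skew (i j : Fin n) (hij : i ≠ j) : Rel n (B j i) (-B i j)
  | square (i j : Fin n) (hij : i ≠ j) : Rel n (B i j * B i j) 0
  | comm (i j k l : Fin n) (hij : i ≠ j) (hkl : k ≠ l)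
      (hik : i ≠ k) (hil : i ≠ l) (hjk : j ≠ k) (hjl : j ≠ l) :
      Rel n (B i j * B k l) (B k l * B i j)
  | three (i j k : Fin n) (hij : i ≠ j) (hjk : j ≠ k) (hki : k ≠ i) :
      Rel n (B i j * B j k + B j k * B k i + B k i * B i j) 0
  | reflect (i j : Fin n) (hij : i ≠ j) (f : Mero n) :
      Rel n (B i j * F f) (F (Mero.swap i j f) * B i j)

/-- The algebra `Ẽ_n(ψ_ij = 0)`. -/
def Alg (n : ℕ) : Type := RingQuot (Rel n)

instance (n : ℕ) : Ring (Alg n) := inferInstanceAs (Ring (RingQuot (Rel n)))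

instance (n : ℕ) : Algebra ℂ (Alg n) := inferInstanceAs (Algebra ℂ (RingQuot (Rel n)))

/-- The quotient map from the free algebra. -/
def mk (n : ℕ) : FreeAlgebra ℂ (Gen n) →ₐ[ℂ] Alg n := RingQuot.mkAlgHom ℂ (Rel n)

theorem mk_rel {n : ℕ} {a b : FreeAlgebra ℂ (Gen n)} (h : Rel n a b) : mk n a = mk n b :=
  RingQuot.mkAlgHom_rel ℂ h

/-- The bracket `[ij]` in the algebra. -/
def br {n : ℕ} (i j : Fin n) : Alg n := mk n (Gen.B i j)

/-- A meromorphic function, as an element of the algebra. -/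
def fn {n : ℕ} (f : Mero n) : Alg n := mk n (Gen.F f)

/-- The coordinate function `x_i`, as an element of the algebra. -/
def x {n : ℕ} (i : Fin n) : Alg n := fn (Mero.coord i)

/-- The Dunkl element `θ_i = ∑_{j ≠ i} [ij]`. -/
def theta {n : ℕ} (i : Fin n) : Alg n := ∑ j ∈ univ.erase i, br i j

/-- The shifted Dunkl element `θ'_i = x_i + θ_i`. -/
def theta' {n : ℕ} (i : Fin n) : Alg n := x i + theta i

/-! ### Commutation -/

section
variable {n : ℕ}

theorem fn_mul (f g : Mero n) : (fn (f * g) : Alg n) = fn f * fn g := by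
  simpa [fn] using mk_rel (Rel.mul f g)

theorem br_skew {i j : Fin n} (h : i ≠ j) : (br j i : Alg n) = -br i j := by
  simpa [br] using mk_rel (Rel.skew i j h)

theorem br_comm {i j k l : Fin n} (hij : i ≠ j) (hkl : k ≠ l) (hik : i ≠ k) (hil : i ≠ l)
    (hjk : j ≠ k) (hjl : j ≠ l) : (br i j * br k l : Alg n) = br k l * br i j := by
  simpa [br] using mk_rel (Rel.comm i j k l hij hkl hik hil hjk hjl)

theorem br_three {i j k : Fin n} (hij : i ≠ j) (hjk : j ≠ k) (hki : k ≠ i) :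
    (br i j * br j k + br j k * br k i + br k i * br i j : Alg n) = 0 := by
  simpa [br] using mk_rel (Rel.three i j k hij hjk hki)

theorem br_x {i j : Fin n} (h : i ≠ j) (k : Fin n) :
    (br i j * x k : Alg n) = x (Equiv.swap i j k) * br i j := by
  have := mk_rel (Rel.reflect i j h (Mero.coord k))
  rw [Mero.swap_coord] at this
  simpa [br, x, fn] using this

theorem x_comm (i j : Fin n) : Commute (x i : Alg n) (x j) := by
  show _ * _ = _ * _
  simp only [x, ← fn_mul, mul_comm]

theorem comm_aux₁ {A : Type*} [Ring A] (a b c : A) (h₁ : a * b + b * -c + -c * a = 0)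
    (h₂ : -a * c + c * -b + -b * -a = 0) :
    a * b - b * a - c * a + a * c + (c * b - b * c) = 0 := by
  have : a * b - b * a - c * a + a * c + (c * b - b * c) =
      (a * b + b * -c + -c * a) - (-a * c + c * -b + -b * -a) := by
    simp only [mul_neg, neg_mul, neg_neg]
    abel
  rw [this, h₁, h₂, sub_zero]

theorem comm_aux₂ {A : Type*} [Ring A] (p q b s t : A) :
    (p + (b + s)) * (q + (-b + t)) - (q + (-b + t)) * (p + (b + s)) =
      (p * q - q * p) + (s * q - q * s) - (t * p - p * t) + (b * p - q * b) + (b * q - p * b)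
        + (b * t - t * b - s * b + b * s + (s * t - t * s)) := by
  simp only [mul_add, add_mul, mul_neg, neg_mul]
  abel

theorem theta'_comm (i j : Fin n) : Commute (theta' i : Alg n) (theta' j) := by
  rcases eq_or_ne i j with rfl | hij
  · exact Commute.refl _
  set K : Finset (Fin n) := (univ.erase i).erase j with hK
  have hKi : univ.erase i = insert j K := by
    rw [hK, insert_erase]; simp [hij.symm]
  have hKj : univ.erase j = insert i K := by
    rw [hK, erase_right_comm, insert_erase]; simp [hij]
  have hk : ∀ k ∈ K, k ≠ j ∧ k ≠ i := fun k h => by simpa [hK] using h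
  set S : Alg n := ∑ k ∈ K, br i k with hS
  set T : Alg n := ∑ k ∈ K, br j k with hT
  have ei : (theta' i : Alg n) = x i + (br i j + S) := by
    rw [theta', theta, hKi, sum_insert (by simp [hK])]
  have ej : (theta' j : Alg n) = x j + (-br i j + T) := by
    rw [theta', theta, hKj, sum_insert (by simp [hK]), br_skew hij]
  have hSx : S * x j = x j * S := by
    rw [hS, sum_mul, mul_sum]
    refine sum_congr rfl fun k h => ?_
    rw [br_x (hk k h).2.symm, Equiv.swap_apply_of_ne_of_ne hij.symm (hk k h).1.symm]
  have hTx : T * x i = x i * T := by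
    rw [hT, sum_mul, mul_sum]
    refine sum_congr rfl fun k h => ?_
    rw [br_x (hk k h).1.symm, Equiv.swap_apply_of_ne_of_ne hij (hk k h).2.symm]
  have hBi : br i j * x i = x j * br i j := by rw [br_x hij, Equiv.swap_apply_left]
  have hBj : br i j * x j = x i * br i j := by rw [br_x hij, Equiv.swap_apply_right]
  have hxx : (x i * x j : Alg n) = x j * x i := x_comm i j
  have hST : S * T - T * S = ∑ k ∈ K, (br i k * br j k - br j k * br i k) := by
    rw [hS, hT, sum_mul_sum, sum_mul_sum, sum_comm (s := K) (t := K), ← sum_sub_distrib]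
    refine sum_congr rfl fun k h => ?_
    rw [← sum_sub_distrib]
    refine sum_eq_single k (fun l hl hlk => ?_) (fun h' => absurd h h')
    rw [br_comm (hk l hl).2.symm (hk k h).1.symm hij (hk k h).2.symm (hk l hl).1 hlk, sub_self]
  have key : br i j * T - T * br i j - S * br i j + br i j * S + (S * T - T * S) = 0 := by
    rw [hST, hS, hT, sum_mul, mul_sum, sum_mul, mul_sum, ← sum_sub_distrib, ← sum_sub_distrib,
      ← sum_add_distrib, ← sum_add_distrib]
    refine sum_eq_zero fun k h => ?_
    obtain ⟨hkj, hki⟩ := hk k h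
    have r1 := br_three hij hkj.symm hki
    have r2 := br_three hij.symm hki.symm hkj
    rw [br_skew hki.symm] at r1
    rw [br_skew hkj.symm, br_skew hij] at r2
    exact comm_aux₁ _ _ _ r1 r2
  show theta' i * theta' j = theta' j * theta' i
  rw [ei, ej, ← sub_eq_zero]
  rw [comm_aux₂, hxx, hSx, hTx, hBi, hBj, key]
  simp

end

/-! ### Elementary symmetric polynomials and the bracket sums -/

/-- The elementary symmetric polynomial `e_k(y_i | i ∈ I)` in pairwise commuting elements `y_i` of a
ring. -/
def esymm {ι A : Type*} [Ring A] (k : ℕ) (I : Finset ι) (y : ι → A)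
    (hy : ∀ i j, Commute (y i) (y j)) : A :=
  ∑ s ∈ I.powersetCard k, s.noncommProd y (fun i _ j _ _ => hy i j)

open Classical in
/-- The sum of the monomials `[a_1 b_1] ⋯ [a_r b_r]` over all sequences `a_1, …, a_r` of distinct
elements of `I \ I₀` and all sequences `b_1 ≤ ⋯ ≤ b_r` of elements outside `I`. -/
def bracketSum {n : ℕ} (I I₀ : Finset (Fin n)) (r : ℕ) : Alg n :=
  ∑ p : (Fin r → Fin n) × (Fin r → Fin n) with
      (∀ t, p.1 t ∈ I \ I₀) ∧ (∀ t, p.2 t ∉ I) ∧ Function.Injective p.1 ∧ Monotone p.2,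
    (List.ofFn fun t => br (p.1 t) (p.2 t)).prod

end FKDegenerate

end

open Finset

noncomputable section

namespace FKDegenerate

/-! ### Sums over subsets -/

section Subsets
variable {ι M : Type*} [DecidableEq ι] [AddCommMonoid M]

/-! All degrees are treated at once. Let `L` list the complement of `I`. The identity proved is that
`∏_{i ∈ I} (1 + θ'_i)` equals the sum of `x_S * blockSum L Y` over disjoint `S, Y ⊆ I`. Here
`blockSum L Y` collects the monomials `[a_1 b_1] ⋯ [a_r b_r]` with `{a_t} = Y` and weakly increasing
`b`. Grouping equal `b`'s turns it into a product of order sums, one for each centre `c ∈ L`.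

The induction on `I` moves an index `j` from `L` into `I`, and the right side must get multiplied by
`1 + θ'_j`. The new terms are of three kinds. If `j` lies in neither set, peeling off a last factor
`[aj] = -[ja]` accounts for `1` and for the `[ji]` with `i ∈ I \ S` outside `Y`. If `j ∈ Y`, the
three-term relation pushes the factor `[jc]` to the right (`mul_orderSum`, `blockSum_insert`). This
gives the `[jc]` with `c ∈ L` and the `[ji]` with `i ∈ Y`, once the cyclic relation
`loopSum_eq_zero` has killed the surplus. If `j ∈ S`, moving `x_j` across the brackets accounts for
`x_j` and the `[ji]` with `i ∈ S` (`sum_xProd_mul_blockSum_cons`).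

The relations being homogeneous, scaling all generators by an indeterminate and taking coefficients
isolates degree `k`. -/

theorem sum_powerset_erase_comm (X : Finset ι) (f : ι → Finset ι → M) :
    ∑ a ∈ X, ∑ B ∈ (X.erase a).powerset, f a B = ∑ B ∈ X.powerset, ∑ a ∈ X \ B, f a B := by
  refine sum_comm' fun a B => ?_
  simp only [mem_powerset, mem_sdiff, subset_erase]
  tauto

theorem sum_powerset_sum_mem (X : Finset ι) (f : ι → Finset ι → M) :
    ∑ B ∈ X.powerset, ∑ a ∈ B, f a (B.erase a) =
      ∑ a ∈ X, ∑ B ∈ (X.erase a).powerset, f a B := by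
  rw [sum_sigma', sum_sigma']
  refine sum_bij' (fun p _ => ⟨p.2, p.1.erase p.2⟩) (fun p _ => ⟨insert p.1 p.2, p.1⟩)
    ?_ ?_ ?_ ?_ ?_
  · rintro ⟨B, a⟩ h
    simp only [mem_sigma, mem_powerset] at h ⊢
    exact ⟨h.1 h.2, erase_subset_erase _ h.1⟩
  · rintro ⟨a, B⟩ h
    simp only [mem_sigma, mem_powerset, subset_erase] at h ⊢
    exact ⟨insert_subset h.1 h.2.1, mem_insert_self _ _⟩
  · rintro ⟨B, a⟩ h
    simp only [mem_sigma, mem_powerset] at h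
    simp [insert_erase h.2]
  · rintro ⟨a, B⟩ h
    simp only [mem_sigma, mem_powerset, subset_erase] at h
    simp [erase_insert h.2.2]
  · intros; rfl

theorem sum_powerset_sdiff_comm (X : Finset ι) (f : Finset ι → Finset ι → M) :
    ∑ B ∈ X.powerset, ∑ D ∈ (X \ B).powerset, f B D =
      ∑ D ∈ X.powerset, ∑ B ∈ (X \ D).powerset, f B D := by
  refine sum_comm' fun B D => ?_
  simp only [mem_powerset, subset_sdiff]
  rw [disjoint_comm]
  tauto

theorem sum_powerset_powerset (X : Finset ι) (f : Finset ι → Finset ι → M) :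
    ∑ B ∈ X.powerset, ∑ D ∈ B.powerset, f (B \ D) D =
      ∑ D ∈ X.powerset, ∑ B ∈ (X \ D).powerset, f B D := by
  rw [sum_sigma', sum_sigma']
  refine sum_bij' (fun p _ => ⟨p.2, p.1 \ p.2⟩) (fun p _ => ⟨p.2 ∪ p.1, p.1⟩)
    ?_ ?_ ?_ ?_ ?_
  · rintro ⟨B, D⟩ h
    simp only [mem_sigma, mem_powerset] at h ⊢
    exact ⟨h.2.trans h.1, sdiff_subset_sdiff h.1 subset_rfl⟩
  · rintro ⟨D, B⟩ h
    simp only [mem_sigma, mem_powerset, subset_sdiff] at h ⊢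
    exact ⟨union_subset h.2.1 h.1, subset_union_right⟩
  · rintro ⟨B, D⟩ h
    simp only [mem_sigma, mem_powerset] at h
    simp [sdiff_union_of_subset h.2]
  · rintro ⟨D, B⟩ h
    simp only [mem_sigma, mem_powerset, subset_sdiff] at h
    simp [union_sdiff_cancel_right h.2.2]
  · intros; rfl

theorem sum_powerset_compl (X : Finset ι) (f : Finset ι → Finset ι → M) :
    ∑ B ∈ X.powerset, f (X \ B) B = ∑ B ∈ X.powerset, f B (X \ B) := by
  refine sum_bij' (fun B _ => X \ B) (fun B _ => X \ B) ?_ ?_ ?_ ?_ ?_ <;>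
    intro B hB <;> simp only [mem_powerset] at hB ⊢ <;>
    simp [sdiff_subset, inter_eq_right.2 hB]

theorem sum_sum_erase_comm (X : Finset ι) (f : ι → ι → M) :
    ∑ a ∈ X, ∑ b ∈ X.erase a, f a b = ∑ b ∈ X, ∑ a ∈ X.erase b, f a b := by
  refine sum_comm' fun a b => ?_
  simp only [mem_erase]
  tauto

end Subsets

/-! ### Sums over all orderings of a finite set -/

section Orderings
variable {ι A : Type*} [DecidableEq ι] [Ring A]

/-- The sum of `w a_1 ⋯ w a_k` over all sequences of distinct elements `a_1, …, a_k` of `X`. -/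
def arrangementSum (w : ι → A) : ℕ → Finset ι → A
  | 0, _ => 1
  | k + 1, X => ∑ a ∈ X, w a * arrangementSum w k (X.erase a)

/-- The sum of `w a_1 ⋯ w a_k` over all orderings `a_1, …, a_k` of `X`. -/
def orderSum (w : ι → A) (X : Finset ι) : A := arrangementSum w X.card X

variable (w : ι → A)

@[simp]
theorem orderSum_empty : orderSum w ∅ = 1 := rfl

theorem orderSum_eq_left (X : Finset ι) :
    orderSum w X = (if X = ∅ then 1 else 0) + ∑ a ∈ X, w a * orderSum w (X.erase a) := by
  rcases X.eq_empty_or_nonempty with rfl | hX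
  · simp
  · rw [if_neg hX.ne_empty, zero_add, orderSum]
    obtain ⟨k, hk⟩ := Nat.exists_eq_succ_of_ne_zero hX.card_pos.ne'
    rw [hk, arrangementSum]
    refine sum_congr rfl fun a ha => ?_
    rw [orderSum, card_erase_of_mem ha, hk]
    rfl

/-- Expanding at both ends, by the left recursion and by induction, gives on each side the sum over
ordered pairs (first letter, last letter), plus the one-letter terms. -/
theorem orderSum_eq_right (X : Finset ι) :
    orderSum w X = (if X = ∅ then 1 else 0) + ∑ a ∈ X, orderSum w (X.erase a) * w a := by
  induction X using Finset.strongInduction with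
  | H X ih =>
    have h1 : ∑ a ∈ X, w a * orderSum w (X.erase a) =
        ∑ a ∈ X, w a * (if X.erase a = ∅ then 1 else 0) +
          ∑ a ∈ X, ∑ b ∈ X.erase a, w a * (orderSum w ((X.erase a).erase b) * w b) := by
      rw [← sum_add_distrib]
      refine sum_congr rfl fun a ha => ?_
      rw [ih _ (erase_ssubset ha), mul_add, mul_sum]
    have h2 : ∑ a ∈ X, orderSum w (X.erase a) * w a =
        ∑ a ∈ X, (if X.erase a = ∅ then 1 else 0) * w a +
          ∑ a ∈ X, ∑ b ∈ X.erase a, (w b * orderSum w ((X.erase a).erase b)) * w a := by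
      rw [← sum_add_distrib]
      refine sum_congr rfl fun a ha => ?_
      rw [orderSum_eq_left w (X.erase a), add_mul, sum_mul]
    rw [orderSum_eq_left, h1, h2, sum_sum_erase_comm]
    congr 2
    · refine sum_congr rfl fun a _ => ?_
      split_ifs <;> simp
    · refine sum_congr rfl fun a _ => sum_congr rfl fun b _ => ?_
      rw [erase_right_comm, mul_assoc]

variable {w}

theorem commute_orderSum {z : A} {X : Finset ι} (h : ∀ a ∈ X, Commute z (w a)) :
    Commute z (orderSum w X) := by
  induction X using Finset.strongInduction with
  | H X ih =>
    rw [orderSum_eq_left]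
    refine Commute.add_right (by split_ifs <;> simp) (Commute.sum_right _ _ _ fun a ha => ?_)
    exact (h a ha).mul_right (ih _ (erase_ssubset ha) fun b hb => h b (mem_of_mem_erase hb))

variable (w)

theorem erase_sdiff_erase {X B : Finset ι} {a : ι} (ha : a ∈ B) :
    (X.erase a) \ (B.erase a) = X \ B := by
  ext b
  simp only [mem_sdiff, mem_erase]
  by_cases h : b = a
  · subst h; simp [ha]
  · simp [h]

/-- Peels the first letter `a` off the order sum. The surrounding factors depend only on `X \ B`,
which is unchanged when `a ∈ B` is erased from both sets; `B = ∅` yields the separate term. -/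
theorem sum_mul_orderSum_mul_left (X : Finset ι) (f g : Finset ι → A) :
    ∑ B ∈ X.powerset, f (X \ B) * orderSum w B * g (X \ B) = f X * g X +
      ∑ a ∈ X, ∑ B ∈ (X.erase a).powerset,
        f ((X.erase a) \ B) * (w a * orderSum w B) * g ((X.erase a) \ B) := by
  rw [← sum_powerset_sum_mem X fun a B =>
    f ((X.erase a) \ B) * (w a * orderSum w B) * g ((X.erase a) \ B)]
  have : f X * g X = ∑ B ∈ X.powerset, if B = ∅ then f X * g X else 0 := by simp
  rw [this, ← sum_add_distrib]
  refine sum_congr rfl fun B _ => ?_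
  rw [orderSum_eq_left, mul_add, add_mul, mul_sum, sum_mul]
  congr 1
  · split_ifs with h <;> simp [h]
  · refine sum_congr rfl fun a ha => ?_
    rw [erase_sdiff_erase ha]

theorem sum_mul_orderSum_mul_right (X : Finset ι) (f g : Finset ι → A) :
    ∑ B ∈ X.powerset, f (X \ B) * orderSum w B * g (X \ B) = f X * g X +
      ∑ a ∈ X, ∑ B ∈ (X.erase a).powerset,
        f ((X.erase a) \ B) * (orderSum w B * w a) * g ((X.erase a) \ B) := by
  rw [← sum_powerset_sum_mem X fun a B =>
    f ((X.erase a) \ B) * (orderSum w B * w a) * g ((X.erase a) \ B)]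
  have : f X * g X = ∑ B ∈ X.powerset, if B = ∅ then f X * g X else 0 := by simp
  rw [this, ← sum_add_distrib]
  refine sum_congr rfl fun B _ => ?_
  rw [orderSum_eq_right, mul_add, add_mul, mul_sum, sum_mul]
  congr 1
  · split_ifs with h <;> simp [h]
  · refine sum_congr rfl fun a ha => ?_
    rw [erase_sdiff_erase ha]

/-- Each ordering is cut at `m`, with `Y` the set of letters before it. -/
theorem orderSum_insert {X : Finset ι} {m : ι} (hm : m ∉ X) :
    orderSum w (insert m X) =
      ∑ Y ∈ X.powerset, orderSum w Y * w m * orderSum w (X \ Y) := by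
  induction X using Finset.strongInduction with
  | H X ih =>
    have := sum_mul_orderSum_mul_left w X (fun _ => 1) (fun Y => w m * orderSum w Y)
    simp only [one_mul] at this
    simp only [mul_assoc] at this ⊢
    rw [this, orderSum_eq_left, if_neg (insert_ne_empty _ _), zero_add, sum_insert hm,
      erase_insert hm]
    congr 1
    refine sum_congr rfl fun a ha => ?_
    have hma : a ≠ m := fun h => hm (h ▸ ha)
    rw [erase_insert_of_ne hma.symm, ih _ (erase_ssubset ha) (fun h => hm (mem_of_mem_erase h)),
      mul_sum]
    simp only [mul_assoc]

/-- The sum of `w a * w a_1 ⋯ w a_k * w a` over all orderings `a, a_1, …, a_k` of `X`. -/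
def loopSum (X : Finset ι) : A := ∑ a ∈ X, w a * orderSum w (X.erase a) * w a

/-- The sum of `w a * w a_1 ⋯ w a_p * r * w a_{p+1} ⋯ w a_k * w a` over all orderings
`a, a_1, …, a_k` of `X` and all `p`. -/
def markedLoopSum (X : Finset ι) (r : A) : A :=
  ∑ a ∈ X, ∑ Y ∈ (X.erase a).powerset,
    w a * orderSum w Y * r * orderSum w ((X.erase a) \ Y) * w a

theorem loopSum_insert {X : Finset ι} {m : ι} (hm : m ∉ X) :
    loopSum w (insert m X) = w m * orderSum w X * w m + markedLoopSum w X (w m) := by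
  rw [loopSum, sum_insert hm, erase_insert hm, markedLoopSum]
  congr 1
  refine sum_congr rfl fun a ha => ?_
  have hma : a ≠ m := fun h => hm (h ▸ ha)
  rw [erase_insert_of_ne hma.symm, orderSum_insert w (fun h => hm (mem_of_mem_erase h)),
    mul_sum, sum_mul]
  simp only [mul_assoc]

/-- Classification by the letter just before the mark: it is the opening letter of the loop, or an
inner letter, which is then absorbed into the mark. -/
theorem markedLoopSum_eq (X : Finset ι) (r : A) :
    markedLoopSum w X r = ∑ a ∈ X, (w a * r * orderSum w (X.erase a) * w a +
      markedLoopSum w (X.erase a) (w a * r)) := by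
  have h (a : ι) : ∑ Y ∈ (X.erase a).powerset,
      w a * orderSum w Y * r * orderSum w ((X.erase a) \ Y) * w a =
      w a * r * orderSum w (X.erase a) * w a + ∑ b ∈ X.erase a,
        ∑ Y ∈ ((X.erase a).erase b).powerset,
        w a * orderSum w Y * (w b * r) * orderSum w (((X.erase a).erase b) \ Y) * w a := by
    have := sum_mul_orderSum_mul_right w (X.erase a) (fun _ => w a)
      (fun Y => r * orderSum w Y * w a)
    simp only [mul_assoc] at this ⊢
    exact this
  simp only [markedLoopSum, h, sum_add_distrib]
  rw [sum_sum_erase_comm]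
  congr 1
  refine sum_congr rfl fun a _ => sum_congr rfl fun b _ => ?_
  rw [erase_right_comm]

theorem markedLoopSum_sub (X : Finset ι) (r s : A) :
    markedLoopSum w X (r - s) = markedLoopSum w X r - markedLoopSum w X s := by
  simp only [markedLoopSum, mul_sub, sub_mul, sum_sub_distrib]

variable {w}

theorem markedLoopSum_mul_left {X : Finset ι} {u : A} (h : ∀ a ∈ X, Commute u (w a)) (r : A) :
    markedLoopSum w X (u * r) = u * markedLoopSum w X r := by
  simp only [markedLoopSum, mul_sum]
  refine sum_congr rfl fun a ha => sum_congr rfl fun Y hY => ?_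
  have hY' : Commute u (orderSum w Y) :=
    commute_orderSum fun b hb => h b (mem_of_mem_erase (mem_powerset.1 hY hb))
  have := (h a ha).mul_right hY'
  simp only [← mul_assoc]
  rw [mul_assoc u, this.eq]

theorem markedLoopSum_mul_right {X : Finset ι} {u : A} (h : ∀ a ∈ X, Commute u (w a)) (r : A) :
    markedLoopSum w X (r * u) = markedLoopSum w X r * u := by
  simp only [markedLoopSum, sum_mul]
  refine sum_congr rfl fun a ha => sum_congr rfl fun Y hY => ?_
  have hY' : Commute u (orderSum w ((X.erase a) \ Y)) :=
    commute_orderSum fun b hb => h b (mem_of_mem_erase (mem_sdiff.1 hb).1)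
  have := hY'.mul_right (h a ha)
  simp only [mul_assoc]
  rw [this.eq, mul_assoc]

/-- The cyclic relation: if `w a * w b = u b a * w a - w b * u b a` with `u b a` commuting with all
other `w c`, and if `w a * w a = 0`, then the loop sums vanish. -/
theorem loopSum_eq_zero {u : ι → ι → A} (X : Finset ι)
    (hsq : ∀ a ∈ X, w a * w a = 0)
    (hex : ∀ a ∈ X, ∀ b ∈ X, a ≠ b → w a * w b = u b a * w a - w b * u b a)
    (hu : ∀ a ∈ X, ∀ b ∈ X, a ≠ b → ∀ c ∈ X, c ≠ a → c ≠ b → Commute (u b a) (w c)) :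
    loopSum w X = 0 := by
  induction X using Finset.strongInduction with
  | H X ih =>
    have ih' (Y) (hY : Y ⊂ X) : loopSum w Y = 0 :=
      ih Y hY (fun a ha => hsq a (hY.1 ha))
        (fun a ha b hb => hex a (hY.1 ha) b (hY.1 hb))
        (fun a ha b hb hab c hc => hu a (hY.1 ha) b (hY.1 hb) hab c (hY.1 hc))
    rcases X.eq_empty_or_nonempty with rfl | ⟨m, hm⟩
    · simp [loopSum]
    obtain ⟨X, hmX, rfl⟩ : ∃ Y, m ∉ Y ∧ insert m Y = X :=
      ⟨X.erase m, notMem_erase _ _, insert_erase hm⟩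
    rcases X.eq_empty_or_nonempty with rfl | hne
    · simp [loopSum, hsq m hm]
    -- The terms are grouped by the cyclic predecessor `a` of `m`: the loop starts at `m` and has
    -- `a` as its last inner letter, or starts at `a` followed by `m`, or contains `a m` in its
    -- interior.
    rw [loopSum_insert w hmX, orderSum_eq_right, if_neg hne.ne_empty, zero_add,
      markedLoopSum_eq, mul_sum, sum_mul, ← sum_add_distrib]
    refine sum_eq_zero fun a ha => ?_
    have hma : a ≠ m := fun h => hmX (h ▸ ha)
    have hmXa : m ∉ X.erase a := fun h => hmX (mem_of_mem_erase h)
    have haX := mem_insert_of_mem (b := m) ha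
    have hc : ∀ c ∈ X.erase a, Commute (u m a) (w c) := fun c hc =>
      hu a haX m hm hma c (mem_insert_of_mem (mem_of_mem_erase hc)) (ne_of_mem_erase hc)
        fun h => hmX (h ▸ mem_of_mem_erase hc)
    have hP : Commute (u m a) (orderSum w (X.erase a)) := commute_orderSum hc
    have h1 := ih' X (ssubset_insert hmX)
    have h2 : loopSum w (insert m (X.erase a)) = 0 := by
      refine ih' _ ⟨insert_subset_insert _ (erase_subset _ _), fun h => ?_⟩
      have := h haX
      simp [hma] at this
    rw [loopSum_insert w hmXa] at h2
    rw [← insert_erase ha, loopSum_insert w (notMem_erase _ _)] at h1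
    rw [hex a haX m hm hma, markedLoopSum_sub, markedLoopSum_mul_left hc,
      markedLoopSum_mul_right hc]
    have e : ∀ p q r s t v : A, Commute s p →
        q * (p * r) * q + (((s * r - q * s) * p * r) + (s * t - v * s)) =
        q * p * (r * q - (s * r - q * s)) + s * (r * p * r + t) - (q * p * q + v) * s := by
      intro p q r s t v h
      have h' := h.eq
      simp only [mul_sub, sub_mul, mul_add, add_mul, mul_assoc]
      rw [← mul_assoc s p r, h', mul_assoc p s r]
      abel
    rw [e _ _ _ _ _ _ hP, h1, h2, hex a haX m hm hma]
    simp

/-- With the first letter `a` split off, the summands `w b`, `b ≠ a`, cancel by induction on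
`X.erase a`; what remains is the loop sum. -/
theorem orderSum_mul_sum {u : ι → ι → A} (X : Finset ι)
    (hsq : ∀ a ∈ X, w a * w a = 0)
    (hex : ∀ a ∈ X, ∀ b ∈ X, a ≠ b → w a * w b = u b a * w a - w b * u b a)
    (hu : ∀ a ∈ X, ∀ b ∈ X, a ≠ b → ∀ c ∈ X, c ≠ a → c ≠ b → Commute (u b a) (w c)) :
    orderSum w X * ∑ a ∈ X, w a = 0 := by
  induction X using Finset.strongInduction with
  | H X ih =>
    rcases X.eq_empty_or_nonempty with rfl | hne
    · simp
    rw [orderSum_eq_left, if_neg hne.ne_empty, zero_add, sum_mul, ← loopSum_eq_zero X hsq hex hu,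
      loopSum]
    refine sum_congr rfl fun a ha => ?_
    have := ih _ (erase_ssubset ha) (fun a ha => hsq a (mem_of_mem_erase ha))
        (fun a ha b hb => hex a (mem_of_mem_erase ha) b (mem_of_mem_erase hb))
        (fun a ha b hb hab c hc => hu a (mem_of_mem_erase ha) b (mem_of_mem_erase hb) hab c
          (mem_of_mem_erase hc))
    rw [← add_sum_erase _ _ ha, mul_add, mul_assoc (w a) _ (∑ a ∈ X.erase a, w a), this]
    simp

end Orderings

/-! ### Brackets in an arbitrary ring -/

/-- Elements `w i j` and `x i` of a ring satisfying the homogeneous quadratic relations of the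
degenerate algebra. -/
structure IsBracketSystem {ι A : Type*} [DecidableEq ι] [Ring A] (w : ι → ι → A) (x : ι → A) :
    Prop where
  skew {i j : ι} (hij : i ≠ j) : w j i = -w i j
  square {i j : ι} (hij : i ≠ j) : w i j * w i j = 0
  comm {i j k l : ι} (hij : i ≠ j) (hkl : k ≠ l) (hik : i ≠ k) (hil : i ≠ l) (hjk : j ≠ k)
    (hjl : j ≠ l) : Commute (w i j) (w k l)
  three {i j k : ι} (hij : i ≠ j) (hjk : j ≠ k) (hki : k ≠ i) :
    w i j * w j k + w j k * w k i + w k i * w i j = 0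
  reflect {i j : ι} (hij : i ≠ j) (k : ι) : w i j * x k = x (Equiv.swap i j k) * w i j
  comm_x (i j : ι) : Commute (x i) (x j)

/-- The sum, over all ways to distribute `X` into blocks indexed by the list `L`, of the products
over `c ∈ L` of the order sums of `a ↦ w a c` over the block of `c`. -/
def blockSum {ι A : Type*} [DecidableEq ι] [Ring A] (w : ι → ι → A) : List ι → Finset ι → A
  | [], X => if X = ∅ then 1 else 0
  | c :: L, X => ∑ B ∈ X.powerset, orderSum (w · c) B * blockSum w L (X \ B)

/-! ### Block sums: commutation and the first factor -/

section BlockSum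
variable {ι A : Type*} [DecidableEq ι] [Ring A] {w : ι → ι → A}

theorem commute_blockSum {z : A} {L : List ι} {X : Finset ι}
    (h : ∀ a ∈ X, ∀ c ∈ L, Commute z (w a c)) : Commute z (blockSum w L X) := by
  induction L generalizing X with
  | nil => rw [blockSum]; split_ifs <;> simp
  | cons c L ih =>
    refine Commute.sum_right _ _ _ fun B hB => Commute.mul_right ?_ ?_
    · exact commute_orderSum fun a ha => h a (mem_powerset.1 hB ha) c (by simp)
    · exact ih fun a ha d hd => h a (mem_sdiff.1 ha).1 d (by simp [hd])

theorem blockSum_empty (L : List ι) : blockSum w L ∅ = 1 := by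
  induction L with
  | nil => simp [blockSum]
  | cons c L ih => simp [blockSum, ih]

/-- Either the block of `c` is empty or the product starts with some `w a c`. This is the recursion
that `sum_sequencePairs` matches with sequences. -/
theorem blockSum_cons_eq (c : ι) (L : List ι) (X : Finset ι) :
    blockSum w (c :: L) X =
      blockSum w L X + ∑ a ∈ X, w a c * blockSum w (c :: L) (X.erase a) := by
  have := sum_mul_orderSum_mul_left (w · c) X (fun _ => 1) (blockSum w L)
  simp only [one_mul] at this
  rw [blockSum, this]
  congr 1
  refine sum_congr rfl fun a _ => ?_
  rw [blockSum, mul_sum]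
  simp only [mul_assoc]

end BlockSum

/-! ### Moving an index across order sums and block sums -/

namespace IsBracketSystem
variable {ι A : Type*} [DecidableEq ι] [Ring A] {w : ι → ι → A} {x : ι → A}

/-- The three-term relation in the form that `loopSum_eq_zero` takes as hypothesis, with `u = w`. -/
theorem exchange (h : IsBracketSystem w x) {a b c : ι} (hab : a ≠ b) (hac : a ≠ c) (hbc : b ≠ c) :
    w a c * w b c = w b a * w a c - w b c * w b a := by
  have := h.three hab.symm hac hbc.symm
  rw [h.skew hbc] at this
  simp only [mul_neg, neg_mul] at this
  rw [eq_sub_iff_add_eq, ← sub_eq_zero, ← neg_eq_zero, ← this]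
  abel

theorem exchange' (h : IsBracketSystem w x) {a j c : ι} (haj : a ≠ j) (hac : a ≠ c) (hjc : j ≠ c) :
    w j c * w a c = w a c * w j a + w a j * w j c := by
  rw [h.exchange haj.symm hjc hac, h.skew haj, mul_neg]
  abel

theorem orderSum_mul_sum_eq_zero (h : IsBracketSystem w x) {j : ι} {B : Finset ι} (hj : j ∉ B) :
    orderSum (w · j) B * ∑ i ∈ B, w j i = 0 := by
  have hne : ∀ a ∈ B, a ≠ j := fun a ha e => hj (e ▸ ha)
  rw [sum_congr rfl fun i hi => h.skew (hne i hi), sum_neg_distrib, mul_neg, neg_eq_zero]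
  exact orderSum_mul_sum (u := w) B (fun a ha => h.square (hne a ha))
    (fun a ha b hb hab => h.exchange hab (hne a ha) (hne b hb)) fun a ha b hb hab c hc hca hcb =>
      h.comm hab.symm (hne c hc) hcb.symm (hne b hb) hca.symm (hne a ha)

theorem commute_orderSum_orderSum (h : IsBracketSystem w x) {c d : ι} {B D : Finset ι}
    (hcd : c ≠ d) (hBD : Disjoint B D) (hcB : c ∉ B) (hcD : c ∉ D) (hdB : d ∉ B) (hdD : d ∉ D) :
    Commute (orderSum (w · c) B) (orderSum (w · d) D) :=
  commute_orderSum fun _ hb => (commute_orderSum fun _ ha =>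
    h.comm (ne_of_mem_of_not_mem hb hdD) (ne_of_mem_of_not_mem ha hcB)
      (ne_of_mem_of_not_mem ha (disjoint_right.1 hBD hb)).symm (ne_of_mem_of_not_mem hb hcD)
      (ne_of_mem_of_not_mem ha hdB).symm hcd.symm).symm

/-- When `[jc]` meets `[ac]`, `exchange'` gives two outcomes. In `[ac][ja]` the factor `[ja]`
commutes with all later `[bc]`, and the journey stops at `i = a`. In `[aj][jc]` the factor `[aj]`
joins an order sum centred at `j`, and `[jc]` travels on. `B` records the letters collected before
the stop. -/
theorem mul_orderSum (h : IsBracketSystem w x) {j c : ι} (hjc : j ≠ c) {X : Finset ι} (hj : j ∉ X)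
    (hc : c ∉ X) :
    w j c * orderSum (w · c) X = orderSum (w · j) X * w j c +
      ∑ i ∈ X, ∑ B ∈ (X.erase i).powerset,
        w i c * orderSum (w · c) ((X.erase i) \ B) * orderSum (w · j) B * w j i := by
  induction X using Finset.strongInduction with
  | H X ih =>
    rcases X.eq_empty_or_nonempty with rfl | hne
    · simp
    have hXj : ∀ a ∈ X, a ≠ j := fun a ha e => hj (e ▸ ha)
    have hXc : ∀ a ∈ X, a ≠ c := fun a ha e => hc (e ▸ ha)
    have h1 (i : ι) := sum_mul_orderSum_mul_left (w · j) (X.erase i)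
      (fun Y => w i c * orderSum (w · c) Y) (fun _ => w j i)
    simp only [h1, sum_add_distrib]
    rw [orderSum_eq_left, if_neg hne.ne_empty, zero_add, mul_sum, orderSum_eq_left (w · j) X,
      if_neg hne.ne_empty, zero_add, sum_mul, sum_sum_erase_comm, add_left_comm, ← sum_add_distrib,
      ← sum_add_distrib]
    refine sum_congr rfl fun a ha => ?_
    have hcom : Commute (w j a) (orderSum (w · c) (X.erase a)) := commute_orderSum fun b hb =>
      h.comm (hXj a ha).symm (hXc b (mem_of_mem_erase hb)) (hXj b (mem_of_mem_erase hb)).symm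
        hjc (ne_of_mem_erase hb).symm (hXc a ha)
    rw [← mul_assoc, h.exchange' (hXj a ha) (hXc a ha) hjc, add_mul, mul_assoc _ (w j a), hcom.eq,
      mul_assoc (w a j), ih _ (erase_ssubset ha) (fun e => hj (mem_of_mem_erase e))
      (fun e => hc (mem_of_mem_erase e)), mul_add, ← mul_assoc, ← mul_assoc]
    congr 2
    rw [mul_sum]
    refine sum_congr rfl fun i hi => ?_
    rw [mul_sum, erase_right_comm]
    refine sum_congr rfl fun B hB => ?_
    have hi' := mem_of_mem_erase hi
    have hai : a ≠ i := (ne_of_mem_erase hi).symm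
    have hcom : Commute (w a j) (w i c * orderSum (w · c) (((X.erase i).erase a) \ B)) := by
      refine (h.comm (hXj a ha) (hXc i hi') hai (hXc a ha) (hXj i hi').symm hjc).mul_right
        (commute_orderSum fun b hb => ?_)
      simp only [mem_sdiff, mem_erase] at hb
      exact h.comm (hXj a ha) (hXc b hb.1.2.2) (Ne.symm hb.1.1) (hXc a ha) (hXj b hb.1.2.2).symm hjc
    simp only [← mul_assoc] at hcom ⊢
    rw [mul_assoc (w a j), hcom.eq]

/-- Orderings are cut at `j` and `[jc]` is pushed right by `mul_orderSum`. For fixed `i` and `B`,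
the sum over the part `Y` before the cut reassembles, by `orderSum_insert` with `i` in the place of
`j`, into the order sum of `X \ B`. -/
theorem orderSum_insert_eq (h : IsBracketSystem w x) {j c : ι} (hjc : j ≠ c) {X : Finset ι}
    (hj : j ∉ X) (hc : c ∉ X) :
    orderSum (w · c) (insert j X) = ∑ B ∈ X.powerset,
      orderSum (w · c) (X \ B) * orderSum (w · j) B * (w j c + ∑ i ∈ X \ B, w j i) := by
  have h1 : ∑ Y ∈ X.powerset, orderSum (w · c) Y * w j c * orderSum (w · c) (X \ Y) =
      ∑ Y ∈ X.powerset, (orderSum (w · c) Y * orderSum (w · j) (X \ Y) * w j c +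
        ∑ i ∈ X \ Y, ∑ B ∈ ((X.erase i) \ Y).powerset, orderSum (w · c) Y * w i c *
          orderSum (w · c) (((X.erase i) \ B) \ Y) * (orderSum (w · j) B * w j i)) := by
    refine sum_congr rfl fun Y hY => ?_
    rw [mul_assoc, h.mul_orderSum hjc (fun e => hj (mem_sdiff.1 e).1)
      (fun e => hc (mem_sdiff.1 e).1), mul_add, mul_assoc, mul_sum]
    congr 1
    refine sum_congr rfl fun i hi => ?_
    rw [mul_sum, show (X \ Y).erase i = X.erase i \ Y by
      ext; simp only [mem_sdiff, mem_erase]; tauto]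
    refine sum_congr rfl fun B hB => ?_
    rw [show (X.erase i \ Y) \ B = (X.erase i \ B) \ Y by
      ext; simp only [mem_sdiff, mem_erase]; tauto]
    simp only [mul_assoc]
  rw [orderSum_insert _ hj, h1, sum_add_distrib, ← sum_powerset_erase_comm X fun i Y =>
    ∑ B ∈ ((X.erase i) \ Y).powerset, orderSum (w · c) Y * w i c *
          orderSum (w · c) (((X.erase i) \ B) \ Y) * (orderSum (w · j) B * w j i)]
  simp only [mul_add, mul_sum, sum_add_distrib]
  rw [sum_powerset_compl X fun D B => orderSum (w · c) D * orderSum (w · j) B * w j c]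
  congr 1
  have h2 : ∀ i ∈ X, ∑ Y ∈ (X.erase i).powerset, ∑ B ∈ ((X.erase i) \ Y).powerset,
      orderSum (w · c) Y * w i c *
          orderSum (w · c) (((X.erase i) \ B) \ Y) * (orderSum (w · j) B * w j i) =
      ∑ B ∈ (X.erase i).powerset, orderSum (w · c) (X \ B) * orderSum (w · j) B * w j i := by
    intro i hi
    rw [sum_powerset_sdiff_comm]
    refine sum_congr rfl fun B hB => ?_
    rw [← sum_mul, ← orderSum_insert (w · c) (X := X.erase i \ B) (by simp), ← mul_assoc]
    have hiB : i ∉ B := fun e => by simpa using mem_powerset.1 hB e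
    rw [show insert i (X.erase i \ B) = X \ B by
      ext b; simp only [mem_insert, mem_sdiff, mem_erase]
      by_cases e : b = i
      · subst e; tauto
      · tauto]
  rw [sum_congr rfl h2, sum_powerset_erase_comm]

/-- Brackets from different blocks have disjoint indices, so the block of `j` may be moved to the
right end. -/
theorem blockSum_cons (h : IsBracketSystem w x) {j : ι} {L : List ι} {X : Finset ι}
    (hjL : j ∉ L) (hjX : j ∉ X) (hL : ∀ c ∈ L, c ∉ X) :
    blockSum w (j :: L) X = ∑ B ∈ X.powerset, blockSum w L (X \ B) * orderSum (w · j) B := by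
  rw [blockSum]
  refine sum_congr rfl fun B hB => Commute.eq (commute_blockSum fun a ha c hc => ?_)
  refine (commute_orderSum fun b hb => ?_).symm
  simp only [mem_sdiff] at ha
  have hbX := mem_powerset.1 hB hb
  exact h.comm (ne_of_mem_of_not_mem ha.1 (hL c hc)) (ne_of_mem_of_not_mem hbX hjX)
    (ne_of_mem_of_not_mem hb ha.2).symm (ne_of_mem_of_not_mem ha.1 hjX)
    (ne_of_mem_of_not_mem hbX (hL c hc)).symm (ne_of_mem_of_not_mem hc hjL)

theorem blockSum_perm (h : IsBracketSystem w x) {L L' : List ι} (hLL' : L.Perm L') {X : Finset ι}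
    (hnd : L.Nodup) (hL : ∀ c ∈ L, c ∉ X) : blockSum w L X = blockSum w L' X := by
  induction hLL' generalizing X with
  | nil => rfl
  | cons c _ ih =>
    rw [blockSum, blockSum]
    refine sum_congr rfl fun B hB => ?_
    rw [ih (List.nodup_cons.1 hnd).2 fun d hd e => hL d (by simp [hd]) (mem_sdiff.1 e).1]
  | swap c d L =>
    simp only [blockSum, mul_sum]
    rw [sum_powerset_sdiff_comm X fun B D => orderSum (w · d) B *
      (orderSum (w · c) D * blockSum w L ((X \ B) \ D))]
    refine sum_congr rfl fun B hB => sum_congr rfl fun D hD => ?_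
    simp only [mem_powerset, subset_sdiff] at hB hD
    have hc := hL c (by simp)
    have hd := hL d (by simp)
    have hdc : d ≠ c := fun e => by simp [e] at hnd
    rw [← mul_assoc, (h.commute_orderSum_orderSum hdc hD.2 (fun e => hd (hD.1 e))
      (fun e => hd (hB e)) (fun e => hc (hD.1 e)) (fun e => hc (hB e))).eq, mul_assoc,
      sdiff_right_comm]
  | trans h₁ _ ih₁ ih₂ =>
    rw [ih₁ hnd hL, ih₂ (h₁.nodup_iff.1 hnd) fun c hc => hL c (h₁.mem_iff.2 hc)]

/-- Induction on `L`: `j` sits in the first block, where `orderSum_insert_eq` applies, or in a later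
one. The first case supplies `[jc]` and the `[ji]` with `i` in the block of `c`, the second the
remaining brackets of `j`. -/
theorem blockSum_insert (h : IsBracketSystem w x) {j : ι} {L : List ι} {X : Finset ι}
    (hjL : j ∉ L) (hjX : j ∉ X) (hnd : L.Nodup)
    (hL : ∀ c ∈ L, c ∉ X) :
    blockSum w L (insert j X) = ∑ B ∈ X.powerset, blockSum w L (X \ B) * orderSum (w · j) B *
      ((L.map (w j)).sum + ∑ i ∈ X \ B, w j i) := by
  induction L generalizing X with
  | nil =>
    rw [blockSum, if_neg (insert_ne_empty _ _)]
    refine (sum_eq_zero fun B _ => ?_).symm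
    rw [blockSum]
    split_ifs with hB <;> simp [hB]
  | cons c L ih =>
    simp only [List.mem_cons, not_or] at hjL
    have hcX : c ∉ X := hL c (by simp)
    have hL' : ∀ d ∈ L, d ∉ X := fun d hd => hL d (by simp [hd])
    have h1 : ∀ B ∈ X.powerset, orderSum (w · c) B * blockSum w L (insert j X \ B) =
        ∑ D ∈ (X \ B).powerset, orderSum (w · c) B * blockSum w L ((X \ D) \ B) *
          orderSum (w · j) D * ((L.map (w j)).sum + ∑ i ∈ (X \ D) \ B, w j i) := by
      intro B hB
      rw [insert_sdiff_of_notMem _ fun e => hjX (mem_powerset.1 hB e),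
        ih hjL.2 (fun e => hjX (mem_sdiff.1 e).1) (List.nodup_cons.1 hnd).2
          fun d hd e => hL' d hd (mem_sdiff.1 e).1, mul_sum]
      refine sum_congr rfl fun D _ => ?_
      rw [sdiff_right_comm]
      simp only [mul_assoc]
    -- Here `j` shares its block with `B`; the letters of `D` are regrouped around the centre `j`
    -- and `B \ D` stays with `c`. All factors involving `j` then pass the later blocks.
    have h2 : ∀ B ∈ X.powerset, orderSum (w · c) (insert j B) *
          blockSum w L (insert j X \ insert j B) =
        ∑ D ∈ B.powerset, orderSum (w · c) (B \ D) * blockSum w L ((X \ D) \ (B \ D)) *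
          orderSum (w · j) D * (w j c + ∑ i ∈ B \ D, w j i) := by
      intro B hB
      have hBX := mem_powerset.1 hB
      rw [insert_sdiff_insert, sdiff_insert_of_notMem hjX, h.orderSum_insert_eq hjL.1
        (fun e => hjX (hBX e)) (fun e => hcX (hBX e)), sum_mul]
      refine sum_congr rfl fun D hD => ?_
      have hDB := mem_powerset.1 hD
      have e : (X \ D) \ (B \ D) = X \ B := by
        ext a
        have := @hDB a
        simp only [mem_sdiff]
        tauto
      have hT {z i : ι} (hzi : z ≠ i) (hz : z ∉ X \ B) (hzL : z ∉ L) (hi : i ∉ X \ B)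
          (hiL : i ∉ L) : Commute (w z i) (blockSum w L (X \ B)) :=
        commute_blockSum fun a ha d hd => h.comm hzi
          (ne_of_mem_of_not_mem (mem_sdiff.1 ha).1 (hL' d hd)) (ne_of_mem_of_not_mem ha hz).symm
          (ne_of_mem_of_not_mem hd hzL).symm (ne_of_mem_of_not_mem ha hi).symm
          (ne_of_mem_of_not_mem hd hiL).symm
      have hj' : j ∉ X \ B := fun e => hjX (mem_sdiff.1 e).1
      have hBL {a : ι} (ha : a ∈ B) : a ∉ X \ B ∧ a ∉ L :=
        ⟨fun e => (mem_sdiff.1 e).2 ha, fun e => hL' a e (hBX ha)⟩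
      have c1 : Commute (orderSum (w · j) D) (blockSum w L (X \ B)) :=
        (commute_orderSum fun b hb => (hT (ne_of_mem_of_not_mem (hBX (hDB hb)) hjX)
          (hBL (hDB hb)).1 (hBL (hDB hb)).2 hj' hjL.2).symm).symm
      have c2 : Commute (w j c + ∑ i ∈ B \ D, w j i) (blockSum w L (X \ B)) := by
        refine (hT hjL.1 hj' hjL.2 (fun e => hcX (mem_sdiff.1 e).1)
          (List.nodup_cons.1 hnd).1).add_left (Commute.sum_left _ _ _ fun i hi => ?_)
        have hi' := (mem_sdiff.1 hi).1
        exact hT (ne_of_mem_of_not_mem (hBX hi') hjX).symm hj' hjL.2 (hBL hi').1 (hBL hi').2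
      rw [e, mul_assoc _ _ (blockSum w L (X \ B)), c2.eq, ← mul_assoc, mul_assoc _ _
        (blockSum w L (X \ B)), c1.eq, ← mul_assoc]
    rw [blockSum, sum_powerset_insert hjX, sum_congr rfl h1, sum_congr rfl h2]
    rw [sum_powerset_powerset X fun B D => orderSum (w · c) B * blockSum w L ((X \ D) \ B) *
          orderSum (w · j) D * (w j c + ∑ i ∈ B, w j i)]
    rw [sum_powerset_sdiff_comm, ← sum_add_distrib]
    refine sum_congr rfl fun D _ => ?_
    rw [← sum_add_distrib, blockSum, sum_mul, sum_mul]
    refine sum_congr rfl fun B hB => ?_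
    rw [← mul_add, List.map_cons, List.sum_cons, ← sum_sdiff (mem_powerset.1 hB)]
    congr 1
    abel

theorem blockSum_cons_eq_right (h : IsBracketSystem w x) {j : ι} {L : List ι} {X : Finset ι}
    (hjL : j ∉ L) (hjX : j ∉ X) (hL : ∀ c ∈ L, c ∉ X) :
    blockSum w (j :: L) X =
      blockSum w L X + ∑ a ∈ X, blockSum w (j :: L) (X.erase a) * w a j := by
  have := sum_mul_orderSum_mul_right (w · j) X (blockSum w L) (fun _ => 1)
  simp only [mul_one] at this
  rw [h.blockSum_cons hjL hjX hL, this]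
  congr 1
  refine sum_congr rfl fun a _ => ?_
  rw [h.blockSum_cons hjL (fun e => hjX (mem_of_mem_erase e))
    (fun c hc e => hL c hc (mem_of_mem_erase e)), sum_mul]
  simp only [mul_assoc]

theorem commute_x (h : IsBracketSystem w x) {i j k : ι} (hij : i ≠ j) (hki : k ≠ i) (hkj : k ≠ j) :
    Commute (x k) (w i j) := by
  have := h.reflect hij k
  rw [Equiv.swap_apply_of_ne_of_ne hki hkj] at this
  exact this.symm

/-- A last factor `[aj]` turns `x j` into `x a`, and `x a` commutes with everything to its left
because `a` no longer occurs there. -/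
theorem blockSum_cons_mul_x (h : IsBracketSystem w x) {j : ι} {L : List ι} {X : Finset ι}
    (hjL : j ∉ L) (hjX : j ∉ X) (hL : ∀ c ∈ L, c ∉ X) :
    blockSum w (j :: L) X * x j =
      x j * blockSum w L X + ∑ a ∈ X, x a * blockSum w (j :: L) (X.erase a) * w a j := by
  rw [h.blockSum_cons_eq_right hjL hjX hL, add_mul, sum_mul]
  have hx {z : ι} {L' : List ι} {Y : Finset ι} (hL' : ∀ c ∈ L', c ∉ Y) (hzL : z ∉ L')
      (hzY : z ∉ Y) : Commute (x z) (blockSum w L' Y) :=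
    commute_blockSum fun a ha c hc => h.commute_x (ne_of_mem_of_not_mem ha (hL' c hc))
      (ne_of_mem_of_not_mem ha hzY).symm (ne_of_mem_of_not_mem hc hzL).symm
  rw [(hx hL hjL hjX).eq]
  congr 1
  refine sum_congr rfl fun a ha => ?_
  have haj : a ≠ j := ne_of_mem_of_not_mem ha hjX
  rw [mul_assoc, h.reflect haj, Equiv.swap_apply_right, ← mul_assoc]
  congr 1
  refine (hx ?_ ?_ (notMem_erase _ _)).eq.symm
  · intro c hc e
    rcases List.mem_cons.1 hc with rfl | hc
    · exact hjX (mem_of_mem_erase e)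
    · exact hL c hc (mem_of_mem_erase e)
  · intro e
    rcases List.mem_cons.1 e with e | e
    · exact haj e
    · exact hL a e ha

/-- For each `Y ⊆ X`, the bracket sum over `X` splits into `X \ Y`, which with the `1` produces the
subsets avoiding `j`, and `Y`, which with the brackets to `L` produces those containing `j`. -/
theorem sum_blockSum_insert (h : IsBracketSystem w x) {j : ι} {L : List ι} {X : Finset ι}
    (hjL : j ∉ L) (hjX : j ∉ X) (hnd : L.Nodup) (hL : ∀ c ∈ L, c ∉ X) :
    ∑ Y ∈ (insert j X).powerset, blockSum w L Y =
      ∑ Y ∈ X.powerset, blockSum w (j :: L) Y *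
        (1 + ∑ i ∈ X, w j i + (L.map (w j)).sum) := by
  have hY {Y : Finset ι} (hY : Y ∈ X.powerset) : j ∉ Y ∧ ∀ c ∈ L, c ∉ Y :=
    ⟨fun e => hjX (mem_powerset.1 hY e), fun c hc e => hL c hc (mem_powerset.1 hY e)⟩
  have h1 : ∑ Y ∈ X.powerset, blockSum w (j :: L) Y = ∑ Y ∈ X.powerset, blockSum w L Y -
      ∑ Y ∈ X.powerset, blockSum w (j :: L) Y * ∑ a ∈ X \ Y, w j a := by
    rw [eq_sub_iff_add_eq]
    simp only [mul_sum]
    rw [← sum_powerset_erase_comm X fun a Y => blockSum w (j :: L) Y * w j a,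
      ← sum_powerset_sum_mem X fun a Y => blockSum w (j :: L) Y * w j a, ← sum_add_distrib]
    refine sum_congr rfl fun Y hYX => ?_
    rw [h.blockSum_cons_eq_right hjL (hY hYX).1 (hY hYX).2, add_assoc, ← sum_add_distrib,
      sum_eq_zero, add_zero]
    intro a ha
    rw [h.skew (ne_of_mem_of_not_mem ha (hY hYX).1), mul_neg, add_neg_cancel]
  have h2 : ∀ Y ∈ X.powerset, blockSum w L (insert j Y) =
      blockSum w (j :: L) Y * ((L.map (w j)).sum + ∑ i ∈ Y, w j i) := by
    intro Y hYX
    rw [h.blockSum_insert hjL (hY hYX).1 hnd (hY hYX).2,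
      h.blockSum_cons hjL (hY hYX).1 (hY hYX).2, sum_mul]
    refine sum_congr rfl fun B hB => ?_
    have hBY := mem_powerset.1 hB
    -- `blockSum_insert` only provides `i ∈ Y \ B`; the missing `i ∈ B` may be added freely, by the
    -- cyclic relation centred at `j`.
    rw [← sum_sdiff hBY, ← add_assoc, mul_add _ _ (∑ i ∈ B, w j i), mul_assoc _ _ (∑ i ∈ B, w j i),
      h.orderSum_mul_sum_eq_zero fun e => (hY hYX).1 (hBY e), mul_zero, add_zero]
  rw [sum_powerset_insert hjX, sum_congr rfl h2]
  simp only [mul_add, mul_one, sum_add_distrib]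
  rw [h1]
  have h3 : ∀ Y ∈ X.powerset, blockSum w (j :: L) Y * ∑ i ∈ X, w j i =
      blockSum w (j :: L) Y * ∑ i ∈ X \ Y, w j i + blockSum w (j :: L) Y * ∑ i ∈ Y, w j i := by
    intro Y hYX
    rw [← mul_add, sum_sdiff (mem_powerset.1 hYX)]
  rw [sum_congr rfl h3, sum_add_distrib]
  abel

/-- The product of the `x i` over `i ∈ S`. -/
def xProd (h : IsBracketSystem w x) (S : Finset ι) : A :=
  S.noncommProd x fun i _ j _ _ => h.comm_x i j

theorem xProd_insert (h : IsBracketSystem w x) {S : Finset ι} {j : ι} (hj : j ∉ S) :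
    h.xProd (insert j S) = h.xProd S * x j :=
  noncommProd_insert_of_notMem' _ _ _ _ hj

/-- Moving `x j` left leaves correction terms in which `x a` joins `x_S` and `[aj]` ends the
product. Reindexed by `insert a S`, they cancel against the `[ja]` with `a` in the new set. -/
theorem sum_xProd_mul_blockSum_cons (h : IsBracketSystem w x) {j : ι} {L : List ι} {I : Finset ι}
    (hjL : j ∉ L) (hjI : j ∉ I) (hL : ∀ c ∈ L, c ∉ I) :
    ∑ S ∈ I.powerset, ∑ Y ∈ (I \ S).powerset,
      h.xProd S * (blockSum w (j :: L) Y * (x j + ∑ i ∈ S, w j i)) =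
    ∑ S ∈ I.powerset, ∑ Y ∈ (I \ S).powerset, h.xProd S * (x j * blockSum w L Y) := by
  have h1 : ∀ S ∈ I.powerset, ∀ Y ∈ (I \ S).powerset,
      h.xProd S * (blockSum w (j :: L) Y * (x j + ∑ i ∈ S, w j i)) =
      h.xProd S * (x j * blockSum w L Y) +
        ∑ a ∈ Y, h.xProd S * (x a * blockSum w (j :: L) (Y.erase a) * w a j) +
        ∑ i ∈ S, h.xProd S * (blockSum w (j :: L) Y * w j i) := by
    intro S hS Y hY
    have hYI := (mem_powerset.1 hY).trans sdiff_subset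
    rw [mul_add, h.blockSum_cons_mul_x hjL (fun e => hjI (hYI e)) fun c hc e => hL c hc (hYI e)]
    simp only [mul_add, mul_sum]
  rw [sum_congr rfl fun S hS => sum_congr rfl (h1 S hS)]
  simp only [sum_add_distrib]
  rw [add_assoc, add_eq_left]
  have h2 : ∑ S ∈ I.powerset, ∑ Y ∈ (I \ S).powerset, ∑ a ∈ Y,
        h.xProd S * (x a * blockSum w (j :: L) (Y.erase a) * w a j) =
      ∑ a ∈ I, ∑ S ∈ (I.erase a).powerset, ∑ Y ∈ ((I.erase a) \ S).powerset,
        h.xProd (insert a S) * (blockSum w (j :: L) Y * w a j) := by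
    simp only [fun S => sum_powerset_sum_mem (I \ S) fun a Y =>
      h.xProd S * (x a * blockSum w (j :: L) Y * w a j)]
    rw [← sum_powerset_erase_comm I fun a S => ∑ Y ∈ ((I \ S).erase a).powerset,
      h.xProd S * (x a * blockSum w (j :: L) Y * w a j)]
    refine sum_congr rfl fun a ha => sum_congr rfl fun S hS => ?_
    rw [show (I \ S).erase a = I.erase a \ S by
      ext; simp only [mem_sdiff, mem_erase]; tauto]
    refine sum_congr rfl fun Y hY => ?_
    rw [h.xProd_insert fun e => notMem_erase _ _ (mem_powerset.1 hS e)]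
    simp only [mul_assoc]
  have h3 : ∑ S ∈ I.powerset, ∑ Y ∈ (I \ S).powerset, ∑ a ∈ S,
        h.xProd S * (blockSum w (j :: L) Y * w j a) =
      ∑ a ∈ I, ∑ S ∈ (I.erase a).powerset, ∑ Y ∈ ((I.erase a) \ S).powerset,
        h.xProd (insert a S) * (blockSum w (j :: L) Y * w j a) := by
    rw [← sum_powerset_sum_mem I fun a S => ∑ Y ∈ ((I.erase a) \ S).powerset,
        h.xProd (insert a S) * (blockSum w (j :: L) Y * w j a)]
    refine sum_congr rfl fun S hS => ?_
    rw [sum_comm]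
    refine sum_congr rfl fun a ha => ?_
    rw [erase_sdiff_erase ha, insert_erase ha]
  rw [h2, h3, ← sum_add_distrib]
  refine sum_eq_zero fun a ha => ?_
  simp only [h.skew (ne_of_mem_of_not_mem ha hjI), mul_neg, sum_neg_distrib, add_neg_cancel]

/-- The sets `S` without `j` supply `1`, the brackets to `I \ S` and those to `L`; the sets
containing `j` supply `x j` and the brackets to `S`. -/
theorem sum_xProd_mul_blockSum_insert (h : IsBracketSystem w x) {j : ι} {L : List ι} {I : Finset ι}
    (hjL : j ∉ L) (hjI : j ∉ I) (hnd : L.Nodup) (hL : ∀ c ∈ L, c ∉ I) :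
    ∑ S ∈ (insert j I).powerset, ∑ Y ∈ (insert j I \ S).powerset, h.xProd S * blockSum w L Y =
    (∑ S ∈ I.powerset, ∑ Y ∈ (I \ S).powerset, h.xProd S * blockSum w (j :: L) Y) *
      (1 + (x j + ∑ i ∈ I, w j i + (L.map (w j)).sum)) := by
  have h1 : ∀ S ∈ I.powerset, ∑ Y ∈ (insert j I \ S).powerset, h.xProd S * blockSum w L Y =
      ∑ Y ∈ (I \ S).powerset, h.xProd S * (blockSum w (j :: L) Y *
        (1 + ∑ i ∈ I \ S, w j i + (L.map (w j)).sum)) := by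
    intro S hS
    rw [insert_sdiff_of_notMem _ fun e => hjI (mem_powerset.1 hS e), ← mul_sum,
      h.sum_blockSum_insert hjL (fun e => hjI (mem_sdiff.1 e).1) hnd
      (fun c hc e => hL c hc (mem_sdiff.1 e).1), mul_sum]
  have h2 : ∀ S ∈ I.powerset, ∑ Y ∈ (insert j I \ insert j S).powerset,
      h.xProd (insert j S) * blockSum w L Y =
      ∑ Y ∈ (I \ S).powerset, h.xProd S * (x j * blockSum w L Y) := by
    intro S hS
    rw [insert_sdiff_insert, sdiff_insert_of_notMem hjI,
      h.xProd_insert fun e => hjI (mem_powerset.1 hS e)]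
    simp only [mul_assoc]
  rw [sum_powerset_insert hjI, sum_congr rfl h1, sum_congr rfl h2,
    ← h.sum_xProd_mul_blockSum_cons hjL hjI hL, ← sum_add_distrib, sum_mul]
  refine sum_congr rfl fun S hS => ?_
  rw [← sum_add_distrib, sum_mul]
  refine sum_congr rfl fun Y hY => ?_
  rw [← mul_add, ← mul_add, mul_assoc, ← sum_sdiff (mem_powerset.1 hS)]
  congr 2
  abel

theorem sum_powerset_noncommProd_insert {y : ι → A} (hcomm : ∀ i j, Commute (y i) (y j))
    {I : Finset ι} {j : ι} (hj : j ∉ I) :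
    ∑ S ∈ (insert j I).powerset, S.noncommProd y (fun i _ j _ _ => hcomm i j) =
      (∑ S ∈ I.powerset, S.noncommProd y (fun i _ j _ _ => hcomm i j)) * (1 + y j) := by
  rw [sum_powerset_insert hj, mul_add, mul_one, sum_mul]
  congr 1
  refine sum_congr rfl fun S hS => ?_
  exact noncommProd_insert_of_notMem' _ _ _ _ fun e => hj (mem_powerset.1 hS e)

theorem sum_powerset_noncommProd [Fintype ι] [LinearOrder ι] (h : IsBracketSystem w x)
    {y : ι → A} (hy : ∀ i, y i = x i + ∑ j ∈ univ.erase i, w i j)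
    (hcomm : ∀ i j, Commute (y i) (y j)) (I : Finset ι) :
    ∑ S ∈ I.powerset, S.noncommProd y (fun i _ j _ _ => hcomm i j) =
      ∑ S ∈ I.powerset, ∑ Y ∈ (I \ S).powerset, h.xProd S * blockSum w (Iᶜ.sort (· ≤ ·)) Y := by
  induction I using Finset.induction_on with
  | empty =>
    simp only [empty_sdiff, powerset_empty, sum_singleton, blockSum_empty, mul_one]
    exact (noncommProd_empty _ _).trans (noncommProd_empty _ _).symm
  | insert j I hj ih =>
    set L := (insert j I)ᶜ.sort (· ≤ ·) with hLdef
    have hmem (c : ι) : c ∈ L ↔ c ∉ insert j I := by simp [hLdef]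
    have hnd : L.Nodup := sort_nodup _ _
    have hjL : j ∉ L := by simp [hmem]
    have hL : ∀ c ∈ L, c ∉ I := fun c hc e => (hmem c).1 hc (mem_insert_of_mem e)
    -- In sorted order `j` may stand anywhere; `blockSum_perm` allows it to be put first, as the
    -- recursion needs.
    have hperm : (Iᶜ.sort (· ≤ ·)).Perm (j :: L) := by
      rw [List.perm_ext_iff_of_nodup (sort_nodup _ _) (List.nodup_cons.2 ⟨hjL, hnd⟩)]
      intro a
      simp only [mem_sort, mem_compl, List.mem_cons, hmem, mem_insert]
      by_cases e : a = j
      · simp [e, hj]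
      · simp [e]
    have hyj : y j = x j + ∑ i ∈ I, w j i + (L.map (w j)).sum := by
      rw [hy, add_assoc, ← List.sum_toFinset _ hnd, ← sum_union]
      · congr 2
        ext a
        simp only [mem_erase, mem_univ, and_true, mem_union, List.mem_toFinset, hmem, mem_insert]
        by_cases e : a = j
        · simp [e, hj]
        · simp [e, em]
      · rw [disjoint_left]
        exact fun a ha e => hL a (List.mem_toFinset.1 e) ha
    rw [sum_powerset_noncommProd_insert hcomm hj, ih, hyj,
      h.sum_xProd_mul_blockSum_insert hjL hj hnd hL]
    congr 1
    refine sum_congr rfl fun S _ => sum_congr rfl fun Y hY => ?_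
    rw [h.blockSum_perm hperm (sort_nodup _ _)]
    intro c hc e
    exact mem_compl.1 ((mem_sort _).1 hc) (mem_sdiff.1 (mem_powerset.1 hY e)).1

end IsBracketSystem

/-! ### Homogeneous components -/

section Homogeneous
open Polynomial
variable {ι A : Type*} [DecidableEq ι] [Ring A] {w : ι → ι → A} {x : ι → A}

theorem commute_monomial_one {a b : A} (h : Commute a b) :
    Commute (monomial 1 a) (monomial 1 b) := by
  rw [commute_iff_eq, monomial_mul_monomial, monomial_mul_monomial, h.eq]

/-- Each relation is homogeneous of degree two, hence survives scaling by the central indeterminate,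
whose exponent then records the degree. -/
theorem IsBracketSystem.monomial (h : IsBracketSystem w x) :
    IsBracketSystem (fun i j => Polynomial.monomial 1 (w i j))
      (fun i => Polynomial.monomial 1 (x i)) where
  skew hij := by rw [h.skew hij, monomial_neg]
  square hij := by rw [monomial_mul_monomial, h.square hij, monomial_zero_right]
  comm hij hkl hik hil hjk hjl := commute_monomial_one (h.comm hij hkl hik hil hjk hjl)
  three hij hjk hki := by
    rw [monomial_mul_monomial, monomial_mul_monomial, monomial_mul_monomial, ← map_add, ← map_add,
      h.three hij hjk hki, map_zero]
  reflect hij k := by rw [monomial_mul_monomial, monomial_mul_monomial, h.reflect hij]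
  comm_x i j := commute_monomial_one (h.comm_x i j)

theorem orderSum_monomial (v : ι → A) (X : Finset ι) :
    orderSum (fun a => monomial 1 (v a)) X = monomial X.card (orderSum v X) := by
  induction X using Finset.strongInduction with
  | H X ih =>
    rcases X.eq_empty_or_nonempty with rfl | hne
    · simp
    · rw [orderSum_eq_left, orderSum_eq_left v, if_neg hne.ne_empty, if_neg hne.ne_empty, zero_add,
        zero_add, map_sum]
      refine sum_congr rfl fun a ha => ?_
      rw [ih _ (erase_ssubset ha), monomial_mul_monomial, add_comm, card_erase_add_one ha]

theorem blockSum_monomial (L : List ι) (X : Finset ι) :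
    blockSum (fun a c => monomial 1 (w a c)) L X = monomial X.card (blockSum w L X) := by
  induction L generalizing X with
  | nil =>
    rw [blockSum, blockSum]
    split_ifs with hX <;> simp [hX]
  | cons c L ih =>
    rw [blockSum, blockSum, map_sum]
    refine sum_congr rfl fun B hB => ?_
    rw [orderSum_monomial, ih, monomial_mul_monomial, add_comm,
      card_sdiff_add_card_eq_card (mem_powerset.1 hB)]

theorem noncommProd_monomial {y : ι → A} (hy : ∀ i j, Commute (y i) (y j)) (S : Finset ι) :
    S.noncommProd (fun i => monomial 1 (y i))
      (fun i _ j _ _ => commute_monomial_one (hy i j)) =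
      monomial S.card (S.noncommProd y fun i _ j _ _ => hy i j) := by
  induction S using Finset.induction_on with
  | empty => exact (noncommProd_empty _ _).trans (congrArg C (noncommProd_empty _ _)).symm
  | insert j S hj ih =>
    refine (noncommProd_insert_of_notMem' _ _ _ _ hj).trans ?_
    refine Eq.trans ?_ (congrArg _ (noncommProd_insert_of_notMem' _ _ _ _ hj)).symm
    rw [card_insert_of_notMem hj, ← monomial_mul_monomial]
    exact congrArg (· * _) ih

theorem IsBracketSystem.esymm_eq [Fintype ι] [LinearOrder ι] (h : IsBracketSystem w x)
    {y : ι → A} (hy : ∀ i, y i = x i + ∑ j ∈ univ.erase i, w i j)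
    (hcomm : ∀ i j, Commute (y i) (y j)) (I : Finset ι) (k : ℕ) :
    esymm k I y hcomm = ∑ m ∈ range (k + 1), ∑ S ∈ I.powersetCard m,
      h.xProd S * ∑ Y ∈ (I \ S).powersetCard (k - m), blockSum w (Iᶜ.sort (· ≤ ·)) Y := by
  have key := congrArg (fun p => coeff p k) (h.monomial.sum_powerset_noncommProd
    (y := fun i => Polynomial.monomial 1 (y i)) (fun i => by rw [hy, map_add, map_sum])
    (fun i j => commute_monomial_one (hcomm i j)) I)
  simp only [noncommProd_monomial hcomm, IsBracketSystem.xProd, noncommProd_monomial h.comm_x,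
    blockSum_monomial, monomial_mul_monomial, finsetSum_coeff, coeff_monomial] at key
  rw [esymm, powersetCard_eq_filter, sum_filter, key]
  simp only [powersetCard_eq_filter, sum_filter]
  rw [sum_comm]
  refine sum_congr rfl fun S _ => ?_
  rw [sum_ite_eq]
  split_ifs with hS
  · rw [mul_sum]
    refine sum_congr rfl fun Y _ => ?_
    rw [mem_range] at hS
    have : S.card + Y.card = k ↔ Y.card = k - S.card := by omega
    simp only [this, IsBracketSystem.xProd]
    split_ifs <;> simp
  -- A set `S` with more than `k` elements has no matching `m` and contributes only in degrees above
  -- `k`.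
  · rw [mem_range] at hS
    refine sum_eq_zero fun Y _ => if_neg (by omega)

end Homogeneous

/-! ### Block sums as sums over sequences -/

section Sequences
variable {ι A : Type*} [LinearOrder ι] [Ring A] {w : ι → ι → A}

theorem sum_powersetCard_sum_mem {M : Type*} [AddCommMonoid M] (X : Finset ι) (r : ℕ)
    (f : ι → Finset ι → M) :
    ∑ B ∈ X.powersetCard (r + 1), ∑ a ∈ B, f a (B.erase a) =
      ∑ a ∈ X, ∑ B ∈ (X.erase a).powersetCard r, f a B := by
  simp only [powersetCard_eq_filter, sum_filter]
  rw [← sum_powerset_sum_mem X fun a B => if B.card = r then f a B else 0]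
  refine sum_congr rfl fun B _ => ?_
  split_ifs with hB
  · refine sum_congr rfl fun a ha => ?_
    rw [if_pos (by rw [card_erase_of_mem ha, hB]; rfl)]
  · refine (sum_eq_zero fun a ha => if_neg fun e => hB ?_).symm
    rw [← card_erase_add_one ha, e]

open Classical in
/-- The pairs of a sequence of `r` distinct elements of `X` and a monotone sequence of `r` elements
of the list `L`. -/
def sequencePairs [Fintype ι] (L : List ι) (X : Finset ι) (r : ℕ) :
    Finset ((Fin r → ι) × (Fin r → ι)) :=
  {p | (∀ t, p.1 t ∈ X) ∧ (∀ t, p.2 t ∈ L) ∧ Function.Injective p.1 ∧ Monotone p.2}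

theorem monotone_cons {r : ℕ} {c : ι} {b : Fin r → ι} (hb : Monotone b) (hc : ∀ t, c ≤ b t) :
    Monotone (Fin.cons c b : Fin (r + 1) → ι) := by
  intro s t hst
  induction s using Fin.cases with
  | zero => induction t using Fin.cases with
    | zero => exact le_rfl
    | succ t => simpa using hc t
  | succ s => induction t using Fin.cases with
    | zero => simp at hst
    | succ t => simpa using hb (Fin.succ_le_succ_iff.1 hst)

/-- For `L = c :: L'` strictly increasing, a monotone `b` with `b_1 ≠ c` never takes the value `c`,
while `b_1 = c` leaves the tail unrestricted in `L`. These are the two terms of `blockSum_cons_eq`.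
The second keeps `L` and lowers `r`, whence the inner induction on `r`. -/
theorem sum_sequencePairs [Fintype ι] {L : List ι} (hL : L.Pairwise (· < ·)) (X : Finset ι)
    (r : ℕ) :
    ∑ p ∈ sequencePairs L X r, (List.ofFn fun t => w (p.1 t) (p.2 t)).prod =
      ∑ Y ∈ X.powersetCard r, blockSum w L Y := by
  classical
  induction L generalizing X r with
  | nil =>
    cases r with
    | zero => simp [sequencePairs, blockSum, Subsingleton.monotone,
        Function.injective_of_subsingleton]
    | succ r =>
      rw [sum_eq_zero, sum_eq_zero]
      · intro Y hY
        rw [blockSum, if_neg]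
        rintro rfl
        simp at hY
      · intro p hp
        simp [sequencePairs] at hp
  | cons c L ihL =>
    rw [List.pairwise_cons] at hL
    have hcL : c ∉ L := fun e => lt_irrefl _ (hL.1 c e)
    induction r generalizing X with
    | zero => simp [sequencePairs, blockSum_empty, Subsingleton.monotone,
        Function.injective_of_subsingleton]
    | succ r ihr =>
      rw [sum_congr rfl fun Y _ => blockSum_cons_eq c L Y, sum_add_distrib]
      rw [sum_powersetCard_sum_mem X r fun a Y => w a c * blockSum w (c :: L) Y,
        ← ihL hL.2 X (r + 1), ← sum_filter_not_add_sum_filter _ fun p => p.2 0 = c]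
      congr 1
      · refine sum_congr ?_ fun _ _ => rfl
        ext p
        simp only [sequencePairs, mem_filter, mem_univ, true_and, List.mem_cons]
        constructor
        · rintro ⟨⟨h1, h2, h3, h4⟩, h5⟩
          refine ⟨h1, fun t => (h2 t).resolve_left fun e => ?_, h3, h4⟩
          have h0 := hL.1 _ ((h2 0).resolve_left h5)
          exact absurd (h4 (Fin.zero_le t)) (by rw [e]; exact not_le.2 h0)
        · rintro ⟨h1, h2, h3, h4⟩
          exact ⟨⟨h1, fun t => Or.inr (h2 t), h3, h4⟩, fun e => hcL (e ▸ h2 0)⟩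
      · simp only [← mul_sum, ← ihr]
        simp only [mul_sum]
        rw [sum_sigma']
        refine sum_bij' (fun p _ => ⟨p.1 0, (Fin.tail p.1, Fin.tail p.2)⟩)
          (fun q _ => (Fin.cons q.1 q.2.1, Fin.cons c q.2.2)) ?_ ?_ ?_ ?_ ?_
        · rintro ⟨a, b⟩ hp
          simp only [sequencePairs, mem_filter, mem_univ, true_and, mem_sigma] at hp ⊢
          obtain ⟨⟨h1, h2, h3, h4⟩, rfl⟩ := hp
          refine ⟨h1 0, fun t => mem_erase.2 ⟨fun e => ?_, h1 _⟩, fun t => h2 _,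
            fun s t e => Fin.succ_injective _ (h3 e), fun s t e => h4 (Fin.succ_le_succ_iff.2 e)⟩
          exact Fin.succ_ne_zero t (h3 e)
        · rintro ⟨a, p⟩ hp
          simp only [sequencePairs, mem_filter, mem_univ, true_and, mem_sigma, mem_erase] at hp ⊢
          obtain ⟨h0, h1, h2, h3, h4⟩ := hp
          refine ⟨⟨?_, ?_, ?_, monotone_cons h4 fun t => ?_⟩, by simp⟩
          · simpa [Fin.forall_fin_succ, h0] using fun t => (h1 t).2
          · simpa [Fin.forall_fin_succ] using h2
          · rw [Fin.cons_injective_iff]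
            refine ⟨?_, h3⟩
            rintro ⟨t, e⟩
            exact (h1 t).1 e
          · rcases List.mem_cons.1 (h2 t) with e | e
            · exact e.ge
            · exact (hL.1 _ e).le
        · rintro ⟨a, b⟩ hp
          obtain ⟨-, rfl⟩ := mem_filter.1 hp
          simp
        · rintro ⟨a, p⟩ _
          simp
        · rintro ⟨a, b⟩ hp
          obtain ⟨-, rfl⟩ := mem_filter.1 hp
          simp [List.ofFn_succ, Fin.tail]

end Sequences

/-! ### The degenerate algebra -/

theorem br_square {n : ℕ} {i j : Fin n} (h : i ≠ j) : (br i j * br i j : Alg n) = 0 := by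
  simpa [br] using mk_rel (Rel.square i j h)

theorem isBracketSystem_br (n : ℕ) : IsBracketSystem (br : Fin n → Fin n → Alg n) x where
  skew := br_skew
  square := br_square
  comm := br_comm
  three := br_three
  reflect := br_x
  comm_x := x_comm

theorem bracketSum_eq {n : ℕ} (I S : Finset (Fin n)) (r : ℕ) :
    bracketSum I S r = ∑ Y ∈ (I \ S).powersetCard r, blockSum br (Iᶜ.sort (· ≤ ·)) Y := by
  rw [← sum_sequencePairs (sortedLT_sort _).pairwise, bracketSum]
  refine sum_congr ?_ fun _ _ => rfl
  ext p
  simp [sequencePairs]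

theorem bracketSum_univ {n : ℕ} (S : Finset (Fin n)) (r : ℕ) :
    bracketSum univ S r = if r = 0 then 1 else 0 := by
  rw [bracketSum_eq, compl_univ, sort_empty]
  split_ifs with hr
  · simp [hr, blockSum]
  · refine sum_eq_zero fun Y hY => if_neg ?_
    rintro rfl
    exact hr (mem_powersetCard.1 hY).2.symm

end FKDegenerate

end

theorem proposition4p1 (n : ℕ) :
    (∀ (I : Finset (Fin n)) (k : ℕ),
      FKDegenerate.esymm k I FKDegenerate.theta' FKDegenerate.theta'_comm =
        ∑ m ∈ Finset.range (k + 1), ∑ I₀ ∈ I.powersetCard m,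
          I₀.noncommProd FKDegenerate.x (fun i _ j _ _ => FKDegenerate.x_comm i j) *
            FKDegenerate.bracketSum I I₀ (k - m)) ∧
    (∀ k : ℕ,
      FKDegenerate.esymm k (Finset.univ : Finset (Fin n)) FKDegenerate.theta'
          FKDegenerate.theta'_comm =
        FKDegenerate.esymm k (Finset.univ : Finset (Fin n)) FKDegenerate.x
          FKDegenerate.x_comm) := by
  have main : ∀ (I : Finset (Fin n)) (k : ℕ),
      FKDegenerate.esymm k I FKDegenerate.theta' FKDegenerate.theta'_comm =
        ∑ m ∈ Finset.range (k + 1), ∑ I₀ ∈ I.powersetCard m,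
          I₀.noncommProd FKDegenerate.x (fun i _ j _ _ => FKDegenerate.x_comm i j) *
            FKDegenerate.bracketSum I I₀ (k - m) := by
    intro I k
    simp only [FKDegenerate.bracketSum_eq]
    exact (FKDegenerate.isBracketSystem_br n).esymm_eq (fun _ => rfl) _ I k
  refine ⟨main, fun k => ?_⟩
  -- No `b` exists outside the full index set, so only the bracket-free term `m = k` survives.
  rw [main, Finset.sum_range_succ, Finset.sum_eq_zero, zero_add, FKDegenerate.esymm]
  · simp [FKDegenerate.bracketSum_univ]
  · intro m hm
    rw [Finset.mem_range] at hm
    simp [FKDegenerate.bracketSum_univ, Nat.sub_ne_zero_of_lt hm]
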